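/- Consider the reflected random walk $(S_n)_{n\ge0}$ on the quarter plane $\mathbb N_0^2$, $\mathbb N_0=\{0,1,2,\dots\}$, started at $(i,j)\in\mathbb N_0^2$. From a point with both coordinates positive it moves by a step with law $p_{1,0}=p_{0,1}=\tfrac38$, $p_{-1,0}=p_{0,-1}=\tfrac18$. From a boundary point (a point of $\mathbb N_0^2$ with at least one zero coordinate) it moves by a step with law $(q_{k,\ell})_{(k,\ell)\in\mathbb Z^2}$, the same at all boundary points. All steps are independent. Here $q_{k,\ell}\ge 0$, $\sum_{k,\ell} q_{k,\ell}=1$, $q_{k,\ell}=0$ whenever $k\le-1$ or $\ell\le-1$, and $\sum_{k,\ell} k\,q_{k,\ell}$ and $\sum_{k,\ell}\ell\, q_{k,\ell}$ are finite and positive. Let $Z_{(i,j)}\in\mathbb N_0\cup\{\infty\}$ be the number of times $n\ge0$ at which $S_n$ is a boundary point, and let $f_n(i,j)=\mathbf P(Z_{(i,j)}=n)$. Put $\alpha_0=\beta_0=1$, $\alpha_1=\beta_1=\tfrac13$ and $Q(\alpha,\beta)=\sum_{k,\ell}q_{k,\ell}\alpha^k\beta^\ell$. Then for all $(i,j)\in\mathbb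 N_0^2$, $$f_0(i,j)=\alpha_0^i\beta_0^j-\alpha_1^i\beta_0^j+\alpha_1^i\beta_1^j-\alpha_0^i\beta_1^j=(1-3^{-i})(1-3^{-j}),$$ and for all $n\ge1$, $$f_n(i,j)=\bigl(1-Q(\alpha_1,\beta_0)\bigr)Q(\alpha_1,\beta_0)^{n-1}\alpha_1^i\beta_0^j-\bigl(1-Q(\alpha_1,\beta_1)\bigr)Q(\alpha_1,\beta_1)^{n-1}\alpha_1^i\beta_1^j+\bigl(1-Q(\alpha_0,\beta_1)\bigr)Q(\alpha_0,\beta_1)^{n-1}\alpha_0^i\beta_1^j.$$ Moreover, for every complex $z$ with $|z|\le1$ the three denominators below are nonzero, and $$\sum_{n\ge0}f_n(i,j)z^n=\alpha_0^i\beta_0^j-\frac{1-z}{1-zQ(\alpha_1,\beta_0)}\alpha_1^i\beta_0^j+\frac{1-z}{1-zQ(\alpha_1,\beta_1)}\alpha_1^i\beta_1^j-\frac{1-z}{1-zQ(\alpha_0,\beta_1)}\alpha_0^i\beta_1^j .$$ -/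

import Mathlib

open MeasureTheory ProbabilityTheory
open scoped ENNReal

namespace QuadrantWalk

/-- Interior step weights of the biased simple walk: `3/8` for `(1,0)` and `(0,1)`,
`1/8` for `(-1,0)` and `(0,-1)`, and `0` for every other step. -/
noncomputable def simpleWeights (s : ℤ × ℤ) : ℝ :=
  if s = (1, 0) ∨ s = (0, 1) then 3 / 8
  else if s = (-1, 0) ∨ s = (0, -1) then 1 / 8
  else 0

/-- Admissible reflection weights: a probability mass function on `ℤ²` carried by steps with
non-negative coordinates, whose two mean drifts are finite and positive. -/
structure IsReflectionWeights (q : ℤ × ℤ → ℝ) : Prop where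
  nonneg : ∀ s, 0 ≤ q s
  hasSum_one : HasSum q 1
  eq_zero_of_neg : ∀ k l : ℤ, k ≤ -1 ∨ l ≤ -1 → q (k, l) = 0
  summable_fst : Summable fun s : ℤ × ℤ => (s.1 : ℝ) * q s
  summable_snd : Summable fun s : ℤ × ℤ => (s.2 : ℝ) * q s
  drift_fst_pos : 0 < ∑' s : ℤ × ℤ, (s.1 : ℝ) * q s
  drift_snd_pos : 0 < ∑' s : ℤ × ℤ, (s.2 : ℝ) * q s

/-- `ξ 0, ξ 1, …` and `η 0, η 1, …` are random vectors in `ℤ²`, all mutually independent, every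
`ξ n` having probability mass function `p` and every `η n` having probability mass function `q`. -/
structure IsIncrements {Ω : Type*} [MeasurableSpace Ω] (μ : Measure Ω) (p q : ℤ × ℤ → ℝ)
    (ξ η : ℕ → Ω → ℤ × ℤ) : Prop where
  measurable_interior : ∀ n, Measurable (ξ n)
  measurable_boundary : ∀ n, Measurable (η n)
  law_interior : ∀ n s, μ.real {ω | ξ n ω = s} = p s
  law_boundary : ∀ n s, μ.real {ω | η n ω = s} = q s
  indep : iIndepFun (fun a : ℕ ⊕ ℕ => Sum.elim ξ η a) μ

/-- The interior `{1, 2, …}²` of the quarter plane. -/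
def interiorSet : Set (ℤ × ℤ) := {s | 0 < s.1 ∧ 0 < s.2}

/-- The boundary of the quarter plane: the points of `{0, 1, …}²` outside `{1, 2, …}²`. -/
def boundarySet : Set (ℤ × ℤ) := {s | 0 ≤ s.1 ∧ 0 ≤ s.2 ∧ ¬(0 < s.1 ∧ 0 < s.2)}

open scoped Classical in
/-- The reflected walk started at `x`: it moves by `ξ (n + 1)` from an interior point and by
`η (n + 1)` from a boundary point. -/
noncomputable def walk {Ω : Type*} (ξ η : ℕ → Ω → ℤ × ℤ) (x : ℤ × ℤ) : ℕ → Ω → ℤ × ℤ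
  | 0, _ => x
  | n + 1, ω =>
      walk ξ η x n ω
        + (if walk ξ η x n ω ∈ interiorSet then ξ (n + 1) ω else 0)
        + (if walk ξ η x n ω ∈ boundarySet then η (n + 1) ω else 0)

/-- The number (possibly infinite) of times `n ≥ 0` at which the walk is on the boundary. -/
noncomputable def contacts {Ω : Type*} (ξ η : ℕ → Ω → ℤ × ℤ) (x : ℤ × ℤ) (ω : Ω) : ℝ≥0∞ :=
  ∑' n : ℕ, boundarySet.indicator (fun _ => (1 : ℝ≥0∞)) (walk ξ η x n ω)

/-- `f_n(i, j)`: the probability that the walk started at `(i, j)` has exactly `n` contacts. -/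
noncomputable def contactPmf {Ω : Type*} [MeasurableSpace Ω] (μ : Measure Ω)
    (ξ η : ℕ → Ω → ℤ × ℤ) (n i j : ℕ) : ℝ :=
  μ.real {ω | contacts ξ η ((i : ℤ), (j : ℤ)) ω = n}

/-- `∑_{k,l} q_{k,l} α^k β^l`. -/
noncomputable def stepTransform (q : ℤ × ℤ → ℝ) (α β : ℝ) : ℝ :=
  ∑' s : ℤ × ℤ, q s * α ^ s.1 * β ^ s.2

end QuadrantWalk

namespace QuadrantWalk

/-! The proof is a martingale argument for the pair (position, number of past contacts). Write `F m`
for `contactFormula q m`, a combination of the exponentials `α ^ i * β ^ j` with `α, β ∈ {1, 1/3}`.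
In the interior `F m` is harmonic, because 1 and 1/3 are the two roots of `3/8 * α + 1/8 * α⁻¹ =
1/2`. On the boundary `F 0` vanishes, since it factors as `(1 - 3⁻ⁱ) * (1 - 3⁻ʲ)`, and averaging `F
m` over `q` gives `F (m + 1)`. Hence `F (m - k)` at the current position, with `k` the past contacts
and value 0 once `k > m`, is a bounded martingale started at `F m x` (`transition_remainingFormula`,
`integral_walk_of_transition_eq`).

This martingale must be compared with the indicator of `k = m`. Their difference is at most `2 ^ (m
+ 1) * decayWeight` (`abs_remainingFormula_sub_le`), and the mean of `decayWeight` shrinks by a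
factor `15/16` per step (`transition_decayWeight_le`). So transience enters only through an explicit
supermartingale. Since the probability of `k = m` at time `n` tends to that of exactly `m` contacts
in total, `measureReal_contacts_eq` follows. The generating function then comes from expanding `(1 -
z) / (1 - z * Q)`. -/

/-- The closed quarter plane. -/
def quadrantSet : Set (ℤ × ℤ) := {s | 0 ≤ s.1 ∧ 0 ≤ s.2}

open scoped Classical in
/-- The number of contacts with the boundary strictly before time `n`. -/
noncomputable def contactCount {Ω : Type*} (ξ η : ℕ → Ω → ℤ × ℤ) (x : ℤ × ℤ) (n : ℕ) (ω : Ω) : ℕ :=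
  ∑ k ∈ Finset.range n, if walk ξ η x k ω ∈ boundarySet then 1 else 0

/-! ### The number of contacts as a limit -/

section Count

variable {Ω : Type*} {ξ η : ℕ → Ω → ℤ × ℤ} {x : ℤ × ℤ}

lemma tendsto_contactCount (ω : Ω) :
    Filter.Tendsto (fun n => (contactCount ξ η x n ω : ℝ≥0∞)) Filter.atTop
      (nhds (contacts ξ η x ω)) := by
  classical
  have h := (ENNReal.summable (f := fun n : ℕ =>
    boundarySet.indicator (fun _ => (1 : ℝ≥0∞)) (walk ξ η x n ω))).hasSum.tendsto_sum_nat
  refine h.congr fun n => ?_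
  simp [contactCount, Set.indicator_apply]

lemma contactCount_le_contacts (n : ℕ) (ω : Ω) :
    (contactCount ξ η x n ω : ℝ≥0∞) ≤ contacts ξ η x ω := by
  classical
  have h := ENNReal.sum_le_tsum (f := fun n : ℕ =>
    boundarySet.indicator (fun _ => (1 : ℝ≥0∞)) (walk ξ η x n ω)) (Finset.range n)
  refine le_trans (le_of_eq ?_) h
  simp [contactCount, Set.indicator_apply]

/-- The counts are integers bounded by their limit, so a finite limit is eventually attained. If the
limit is not `m`, infinity included, it has a neighbourhood avoiding `m`. -/
lemma eventually_contactCount_eq_iff (m : ℕ) (ω : Ω) :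
    ∀ᶠ n in Filter.atTop, (contactCount ξ η x n ω = m ↔ contacts ξ η x ω = m) := by
  have ht := tendsto_contactCount (ξ := ξ) (η := η) (x := x) ω
  by_cases hm : contacts ξ η x ω = m
  · have hle : ∀ n, contactCount ξ η x n ω ≤ m := fun n => by
      have := contactCount_le_contacts (ξ := ξ) (η := η) (x := x) n ω
      rw [hm] at this
      exact_mod_cast this
    rcases m with _ | k
    · exact Filter.Eventually.of_forall fun n => by simp [hm, Nat.le_zero.1 (hle n)]
    · have hk : (k : ℝ≥0∞) < contacts ξ η x ω := by rw [hm]; exact_mod_cast k.lt_succ_self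
      filter_upwards [ht.eventually (lt_mem_nhds hk)] with n hn
      have hn' : k < contactCount ξ η x n ω := by exact_mod_cast hn
      have := hle n
      simp only [hm, iff_true]
      omega
  · filter_upwards [ht.eventually (isOpen_ne.mem_nhds hm)] with n hn
    have : contactCount ξ η x n ω ≠ m := fun h => hn (by rw [h])
    simp [hm, this]

end Count

/-! ### Measurability and independence -/

section Measurability

variable {Ω : Type*} [MeasurableSpace Ω] {ξ η : ℕ → Ω → ℤ × ℤ} {x : ℤ × ℤ}

/-- Only increments up to time `n` are assumed measurable, so that the lemma also applies with the
σ-algebra that these increments generate. -/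
lemma measurable_walk {n : ℕ} (hξ : ∀ k ≤ n, Measurable (ξ k)) (hη : ∀ k ≤ n, Measurable (η k)) :
    Measurable (walk ξ η x n) := by
  classical
  induction n with
  | zero => exact measurable_const
  | succ n ih =>
    have hw := ih (fun k hk => hξ k (by omega)) (fun k hk => hη k (by omega))
    refine (hw.add (Measurable.ite (hw (Set.to_countable _).measurableSet) (hξ _ le_rfl)
      measurable_const)).add (Measurable.ite (hw (Set.to_countable _).measurableSet) (hη _ le_rfl)
      measurable_const)

lemma measurable_contactCount {n : ℕ} (hξ : ∀ k < n, Measurable (ξ k))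
    (hη : ∀ k < n, Measurable (η k)) : Measurable (contactCount ξ η x n) := by
  classical
  refine Finset.measurable_sum _ fun k hk => ?_
  have hk' := Finset.mem_range.1 hk
  have hw : Measurable (walk ξ η x k) := measurable_walk (fun l hl => hξ l (by omega))
    (fun l hl => hη l (by omega))
  exact Measurable.ite (hw (Set.to_countable _).measurableSet) measurable_const measurable_const

lemma measurable_walk_contactCount {n : ℕ} (hξ : ∀ k ≤ n, Measurable (ξ k))
    (hη : ∀ k ≤ n, Measurable (η k)) :
    Measurable fun ω => (walk ξ η x n ω, contactCount ξ η x n ω) :=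
  (measurable_walk hξ hη).prodMk
    (measurable_contactCount (fun k hk => hξ k hk.le) (fun k hk => hη k hk.le))

end Measurability

section Independence

variable {Ω : Type*} [mΩ : MeasurableSpace Ω] {μ : Measure Ω} {p q : ℤ × ℤ → ℝ}
  {ξ η : ℕ → Ω → ℤ × ℤ}

/-- The past is a function of the increments with index at most `n`, a family disjoint from `{a}`;
disjoint subfamilies of an independent family generate independent σ-algebras. -/
lemma IsIncrements.indepFun_walk (h : IsIncrements μ p q ξ η) (x : ℤ × ℤ) (n : ℕ) (a : ℕ ⊕ ℕ)
    (ha : a = Sum.inl (n + 1) ∨ a = Sum.inr (n + 1)) :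
    IndepFun (fun ω => (walk ξ η x n ω, contactCount ξ η x n ω)) (Sum.elim ξ η a) μ := by
  set m : ℕ ⊕ ℕ → MeasurableSpace Ω := fun b => MeasurableSpace.comap (Sum.elim ξ η b) inferInstance
  have hle : ∀ b, m b ≤ mΩ := by
    rintro (b | b)
    · exact (h.measurable_interior b).comap_le
    · exact (h.measurable_boundary b).comap_le
  set S : Set (ℕ ⊕ ℕ) := {b | ∃ k ≤ n, b = Sum.inl k ∨ b = Sum.inr k}
  have hdisj : Disjoint S {a} := by
    rw [Set.disjoint_singleton_right]
    rintro ⟨k, hk, hb⟩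
    rcases ha with rfl | rfl <;> rcases hb with hb | hb <;> simp at hb <;> omega
  have hind := indep_iSup_of_disjoint hle h.indep hdisj
  have hV : Measurable[⨆ b ∈ S, m b] fun ω => (walk ξ η x n ω, contactCount ξ η x n ω) := by
    have key : ∀ b ∈ S, Measurable[⨆ b ∈ S, m b] (Sum.elim ξ η b) := fun b hb =>
      (comap_measurable (Sum.elim ξ η b)).mono (le_iSup₂ (f := fun b (_ : b ∈ S) => m b) b hb) le_rfl
    exact @measurable_walk_contactCount Ω (⨆ b ∈ S, m b) ξ η x n
      (fun k hk => key (Sum.inl k) ⟨k, hk, Or.inl rfl⟩)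
      (fun k hk => key (Sum.inr k) ⟨k, hk, Or.inr rfl⟩)
  rw [IndepFun_iff_Indep]
  refine indep_of_indep_of_le_left (indep_of_indep_of_le_right hind ?_) hV.comap_le
  exact le_iSup₂ (f := fun b (_ : b ∈ ({a} : Set (ℕ ⊕ ℕ))) => m b) a rfl

/-- Averaging a bounded function over one of two independent discrete random variables. -/
lemma integral_eq_integral_tsum_of_indepFun [IsProbabilityMeasure μ] {S T : Type*}
    [MeasurableSpace S] [Countable S] [MeasurableSingletonClass S]
    [MeasurableSpace T] [Countable T] [MeasurableSingletonClass T]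
    {V : Ω → S} {U : Ω → T} (hV : Measurable V) (hU : Measurable U) (hVU : IndepFun V U μ)
    {w : T → ℝ} (hw : ∀ s, μ.real {ω | U ω = s} = w s) {h : S → T → ℝ} {C : ℝ}
    (hC : ∀ v s, |h v s| ≤ C) :
    ∫ ω, h (V ω) (U ω) ∂μ = ∫ ω, ∑' s, w s * h (V ω) s ∂μ := by
  have : IsProbabilityMeasure (μ.map V) := Measure.isProbabilityMeasure_map hV.aemeasurable
  have : IsProbabilityMeasure (μ.map U) := Measure.isProbabilityMeasure_map hU.aemeasurable
  have hmap := (indepFun_iff_map_prod_eq_prod_map_map hV.aemeasurable hU.aemeasurable).1 hVU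
  have hm : Measurable fun v : S × T => h v.1 v.2 := measurable_of_countable _
  have hint : Integrable (fun v : S × T => h v.1 v.2) ((μ.map V).prod (μ.map U)) :=
    Integrable.of_bound hm.aestronglyMeasurable C (Filter.Eventually.of_forall fun v => hC _ _)
  calc ∫ ω, h (V ω) (U ω) ∂μ = ∫ v, h v.1 v.2 ∂(μ.map fun ω => (V ω, U ω)) :=
        (integral_map (hV.prodMk hU).aemeasurable hm.aestronglyMeasurable).symm
    _ = ∫ v, ∫ s, h v s ∂(μ.map U) ∂(μ.map V) := by rw [hmap, integral_prod _ hint]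
    _ = ∫ v, ∑' s, w s * h v s ∂(μ.map V) := by
        congr 1
        ext v
        rw [integral_countable]
        · refine tsum_congr fun s => ?_
          rw [smul_eq_mul, ← hw s, map_measureReal_apply hU (measurableSet_singleton s)]
          rfl
        · exact Integrable.of_bound (measurable_of_countable _).aestronglyMeasurable C
            (Filter.Eventually.of_forall fun s => hC _ _)
    _ = ∫ ω, ∑' s, w s * h (V ω) s ∂μ :=
        integral_map hV.aemeasurable (measurable_of_countable _).aestronglyMeasurable

lemma ae_ne_of_law_eq_zero [IsFiniteMeasure μ] {w : ℤ × ℤ → ℝ} {U : Ω → ℤ × ℤ}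
    (hU : ∀ s, μ.real {ω | U ω = s} = w s) : ∀ᵐ ω ∂μ, w (U ω) ≠ 0 := by
  have : ∀ᵐ ω ∂μ, ∀ s, w s = 0 → U ω ≠ s := by
    rw [ae_all_iff]
    intro s
    by_cases hs : w s = 0
    · have h0 : μ {ω | U ω = s} = 0 := by
        have := hU s
        rwa [hs, measureReal_eq_zero_iff] at this
      filter_upwards [measure_eq_zero_iff_ae_notMem.1 h0] with ω hω _ using hω
    · exact Filter.Eventually.of_forall fun ω h => absurd h hs
  filter_upwards [this] with ω hω h0 using hω _ h0 rfl

end Independence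

/-! ### The transition operator -/

lemma mem_quadrantSet_add_of_simpleWeights_ne_zero {x s : ℤ × ℤ} (hx : x ∈ interiorSet)
    (hs : simpleWeights s ≠ 0) : x + s ∈ quadrantSet := by
  obtain ⟨a, b⟩ := x
  obtain ⟨h1, h2⟩ := hx
  unfold simpleWeights at hs
  simp only at h1 h2
  split_ifs at hs with h h'
  · rcases h with rfl | rfl <;> constructor <;> simp <;> omega
  · rcases h' with rfl | rfl <;> constructor <;> simp <;> omega
  · exact absurd rfl hs

lemma IsReflectionWeights.mem_quadrantSet {q : ℤ × ℤ → ℝ} (hq : IsReflectionWeights q)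
    {s : ℤ × ℤ} (hs : q s ≠ 0) : s ∈ quadrantSet := by
  by_contra h
  refine hs (hq.eq_zero_of_neg s.1 s.2 ?_)
  simp only [quadrantSet, Set.mem_ofPred_eq, not_and_or, not_le] at h
  omega

lemma mem_interiorSet_or_mem_boundarySet {x : ℤ × ℤ} (hx : x ∈ quadrantSet) :
    x ∈ interiorSet ∨ x ∈ boundarySet := by
  by_cases h : x ∈ interiorSet
  · exact Or.inl h
  · exact Or.inr ⟨hx.1, hx.2, h⟩

lemma notMem_boundarySet_of_mem_interiorSet {x : ℤ × ℤ} (hx : x ∈ interiorSet) :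
    x ∉ boundarySet := fun h => h.2.2 hx

lemma notMem_interiorSet_of_mem_boundarySet {x : ℤ × ℤ} (hx : x ∈ boundarySet) :
    x ∉ interiorSet := hx.2.2

lemma quadrantSet_add {x s : ℤ × ℤ} (hx : x ∈ quadrantSet) (hs : s ∈ quadrantSet) :
    x + s ∈ quadrantSet := ⟨add_nonneg hx.1 hs.1, add_nonneg hx.2 hs.2⟩

lemma boundarySet_subset {x : ℤ × ℤ} (hx : x ∈ boundarySet) : x ∈ quadrantSet := ⟨hx.1, hx.2.1⟩

lemma tsum_simpleWeights_mul (f : ℤ × ℤ → ℝ) :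
    ∑' s, simpleWeights s * f s
      = 3 / 8 * f (1, 0) + 3 / 8 * f (0, 1) + 1 / 8 * f (-1, 0) + 1 / 8 * f (0, -1) := by
  rw [tsum_eq_sum (s := {((1 : ℤ), (0 : ℤ)), (0, 1), (-1, 0), (0, -1)})]
  · rw [Finset.sum_insert (by decide), Finset.sum_insert (by decide), Finset.sum_insert (by decide),
      Finset.sum_singleton]
    simp only [simpleWeights]
    norm_num
    ring
  · intro s hs
    simp only [Finset.mem_insert, Finset.mem_singleton, not_or] at hs
    simp [simpleWeights, hs]

open scoped Classical in
/-- The transition operator of the walk together with its number of past contacts. -/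
noncomputable def transition (q : ℤ × ℤ → ℝ) (h : ℤ × ℤ → ℕ → ℝ) (x : ℤ × ℤ) (k : ℕ) : ℝ :=
  (if x ∈ interiorSet then ∑' s, simpleWeights s * h (x + s) k else 0)
    + (if x ∈ boundarySet then ∑' s, q s * h (x + s) (k + 1) else 0)

lemma transition_of_mem_interiorSet {q : ℤ × ℤ → ℝ} {h : ℤ × ℤ → ℕ → ℝ} {x : ℤ × ℤ} {k : ℕ}
    (hx : x ∈ interiorSet) : transition q h x k = ∑' s, simpleWeights s * h (x + s) k := by
  simp [transition, hx, notMem_boundarySet_of_mem_interiorSet hx]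

lemma transition_of_mem_boundarySet {q : ℤ × ℤ → ℝ} {h : ℤ × ℤ → ℕ → ℝ} {x : ℤ × ℤ} {k : ℕ}
    (hx : x ∈ boundarySet) : transition q h x k = ∑' s, q s * h (x + s) (k + 1) := by
  simp [transition, hx, notMem_interiorSet_of_mem_boundarySet hx]

/-! ### Markov property, martingales and supermartingales of the walk. -/

section Transition

variable {Ω : Type*} [mΩ : MeasurableSpace Ω] {μ : Measure Ω} [IsProbabilityMeasure μ]
  {q : ℤ × ℤ → ℝ} {ξ η : ℕ → Ω → ℤ × ℤ} {x : ℤ × ℤ}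

lemma ae_walk_mem_quadrantSet (hq : IsReflectionWeights q)
    (hξη : IsIncrements μ simpleWeights q ξ η) (hx : x ∈ quadrantSet) (n : ℕ) :
    ∀ᵐ ω ∂μ, walk ξ η x n ω ∈ quadrantSet := by
  induction n with
  | zero => exact Filter.Eventually.of_forall fun ω => hx
  | succ n ih =>
    filter_upwards [ih, ae_ne_of_law_eq_zero (hξη.law_interior (n + 1)),
      ae_ne_of_law_eq_zero (hξη.law_boundary (n + 1))] with ω h1 h2 h3
    rw [walk]
    rcases mem_interiorSet_or_mem_boundarySet h1 with h | h
    · simpa [h, notMem_boundarySet_of_mem_interiorSet h] using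
        mem_quadrantSet_add_of_simpleWeights_ne_zero h h2
    · simpa [h, notMem_interiorSet_of_mem_boundarySet h] using
        quadrantSet_add h1 (hq.mem_quadrantSet h3)

lemma integrable_walk (hq : IsReflectionWeights q)
    (hξη : IsIncrements μ simpleWeights q ξ η) (hx : x ∈ quadrantSet) {h : ℤ × ℤ → ℕ → ℝ} {C : ℝ}
    (hC : ∀ y ∈ quadrantSet, ∀ k, |h y k| ≤ C) (n : ℕ) :
    Integrable (fun ω => h (walk ξ η x n ω) (contactCount ξ η x n ω)) μ := by
  have hV : Measurable fun ω => (walk ξ η x n ω, contactCount ξ η x n ω) :=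
    measurable_walk_contactCount (fun k _ => hξη.measurable_interior k)
      (fun k _ => hξη.measurable_boundary k)
  have hm : Measurable fun v : (ℤ × ℤ) × ℕ => h v.1 v.2 := measurable_of_countable _
  refine Integrable.of_bound (hm.comp hV).aestronglyMeasurable C ?_
  filter_upwards [ae_walk_mem_quadrantSet hq hξη hx n] with ω hω using hC _ hω _

/-- The Markov property of the walk, in integrated form. -/
lemma integral_walk_succ (hq : IsReflectionWeights q)
    (hξη : IsIncrements μ simpleWeights q ξ η) (hx : x ∈ quadrantSet) {h : ℤ × ℤ → ℕ → ℝ} {C : ℝ}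
    (hC : ∀ y ∈ quadrantSet, ∀ k, |h y k| ≤ C) (n : ℕ) :
    ∫ ω, h (walk ξ η x (n + 1) ω) (contactCount ξ η x (n + 1) ω) ∂μ
      = ∫ ω, transition q h (walk ξ η x n ω) (contactCount ξ η x n ω) ∂μ := by
  classical
  have hC0 : 0 ≤ C := (abs_nonneg _).trans (hC x hx 0)
  set V : Ω → (ℤ × ℤ) × ℕ := fun ω => (walk ξ η x n ω, contactCount ξ η x n ω)
  have hV : Measurable V := measurable_walk_contactCount (fun k _ => hξη.measurable_interior k)
      (fun k _ => hξη.measurable_boundary k)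
  -- As `h` is bounded only on the quadrant, it is cut off outside. The averages do not change,
  -- because steps of nonzero weight stay in the quadrant.
  set hI : (ℤ × ℤ) × ℕ → ℤ × ℤ → ℝ := fun v s =>
    if v.1 ∈ interiorSet ∧ v.1 + s ∈ quadrantSet then h (v.1 + s) v.2 else 0
  set hB : (ℤ × ℤ) × ℕ → ℤ × ℤ → ℝ := fun v s =>
    if v.1 ∈ boundarySet ∧ v.1 + s ∈ quadrantSet then h (v.1 + s) (v.2 + 1) else 0
  have hIC : ∀ v s, |hI v s| ≤ C := fun v s => by
    simp only [hI]
    split_ifs with hv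
    · exact hC _ hv.2 _
    · simpa using hC0
  have hBC : ∀ v s, |hB v s| ≤ C := fun v s => by
    simp only [hB]
    split_ifs with hv
    · exact hC _ hv.2 _
    · simpa using hC0
  have eI := integral_eq_integral_tsum_of_indepFun hV (hξη.measurable_interior (n + 1))
    (hξη.indepFun_walk x n (Sum.inl (n + 1)) (Or.inl rfl)) (hξη.law_interior (n + 1)) hIC
  have eB := integral_eq_integral_tsum_of_indepFun hV (hξη.measurable_boundary (n + 1))
    (hξη.indepFun_walk x n (Sum.inr (n + 1)) (Or.inr rfl)) (hξη.law_boundary (n + 1)) hBC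
  have iI : Integrable (fun ω => hI (V ω) (ξ (n + 1) ω)) μ :=
    Integrable.of_bound ((measurable_of_countable fun v : ((ℤ × ℤ) × ℕ) × (ℤ × ℤ) =>
      hI v.1 v.2).comp (hV.prodMk (hξη.measurable_interior (n + 1)))).aestronglyMeasurable C
      (Filter.Eventually.of_forall fun ω => hIC _ _)
  have iB : Integrable (fun ω => hB (V ω) (η (n + 1) ω)) μ :=
    Integrable.of_bound ((measurable_of_countable fun v : ((ℤ × ℤ) × ℕ) × (ℤ × ℤ) =>
      hB v.1 v.2).comp (hV.prodMk (hξη.measurable_boundary (n + 1)))).aestronglyMeasurable C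
      (Filter.Eventually.of_forall fun ω => hBC _ _)
  have tI : ∀ v : (ℤ × ℤ) × ℕ, ∑' s, simpleWeights s * hI v s
      = if v.1 ∈ interiorSet then ∑' s, simpleWeights s * h (v.1 + s) v.2 else 0 := by
    intro v
    split_ifs with hv
    · refine tsum_congr fun s => ?_
      by_cases hs : simpleWeights s = 0
      · simp [hs]
      · simp [hI, hv, mem_quadrantSet_add_of_simpleWeights_ne_zero hv hs]
    · simp [hI, hv]
  have tB : ∀ v : (ℤ × ℤ) × ℕ, ∑' s, q s * hB v s
      = if v.1 ∈ boundarySet then ∑' s, q s * h (v.1 + s) (v.2 + 1) else 0 := by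
    intro v
    split_ifs with hv
    · refine tsum_congr fun s => ?_
      by_cases hs : q s = 0
      · simp [hs]
      · simp [hB, hv, quadrantSet_add (boundarySet_subset hv) (hq.mem_quadrantSet hs)]
    · simp [hB, hv]
  have bdd : ∀ w : ℤ × ℤ → ℝ, (∀ s, 0 ≤ w s) → HasSum w 1 → ∀ f : ℤ × ℤ → ℝ, (∀ s, |f s| ≤ C) →
      |∑' s, w s * f s| ≤ C := by
    intro w hw hw1 f hf
    have := tsum_of_norm_bounded (f := fun s => w s * f s) (hw1.mul_right C) fun s => by
      rw [norm_mul, Real.norm_of_nonneg (hw s)]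
      exact mul_le_mul_of_nonneg_left (hf s) (hw s)
    simpa using this
  have jI : Integrable (fun ω => ∑' s, simpleWeights s * hI (V ω) s) μ := by
    refine Integrable.of_bound ((measurable_of_countable fun v => ∑' s, simpleWeights s * hI v s).comp
      hV).aestronglyMeasurable C (Filter.Eventually.of_forall fun ω => ?_)
    change |∑' s, simpleWeights s * hI (V ω) s| ≤ C
    rw [tsum_simpleWeights_mul]
    have h1 := abs_le.1 (hIC (V ω) (1, 0))
    have h2 := abs_le.1 (hIC (V ω) (0, 1))
    have h3 := abs_le.1 (hIC (V ω) (-1, 0))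
    have h4 := abs_le.1 (hIC (V ω) (0, -1))
    rw [abs_le]
    constructor <;> linarith
  have jB : Integrable (fun ω => ∑' s, q s * hB (V ω) s) μ :=
    Integrable.of_bound ((measurable_of_countable fun v => ∑' s, q s * hB v s).comp
      hV).aestronglyMeasurable C (Filter.Eventually.of_forall fun ω =>
        bdd q hq.nonneg hq.hasSum_one _ (hBC _))
  calc ∫ ω, h (walk ξ η x (n + 1) ω) (contactCount ξ η x (n + 1) ω) ∂μ
      = ∫ ω, (hI (V ω) (ξ (n + 1) ω) + hB (V ω) (η (n + 1) ω)) ∂μ := by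
        refine integral_congr_ae ?_
        filter_upwards [ae_walk_mem_quadrantSet hq hξη hx n,
          ae_walk_mem_quadrantSet hq hξη hx (n + 1)] with ω h1 h2
        rw [walk] at h2
        rw [walk, contactCount, Finset.sum_range_succ, ← contactCount]
        rcases mem_interiorSet_or_mem_boundarySet h1 with hv | hv
        · have hv' := notMem_boundarySet_of_mem_interiorSet hv
          simp only [hv, hv', if_true, if_false, add_zero] at h2 ⊢
          simp [hI, hB, V, hv, hv', h2]
        · have hv' := notMem_interiorSet_of_mem_boundarySet hv
          simp only [hv, hv', if_true, if_false, add_zero] at h2 ⊢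
          simp [hI, hB, V, hv, hv', h2]
    _ = ∫ ω, (∑' s, simpleWeights s * hI (V ω) s + ∑' s, q s * hB (V ω) s) ∂μ := by
        rw [integral_add iI iB, integral_add jI jB, eI, eB]
    _ = ∫ ω, transition q h (walk ξ η x n ω) (contactCount ξ η x n ω) ∂μ := by
        simp only [tI, tB, transition, V]

lemma integral_walk_of_transition_eq (hq : IsReflectionWeights q)
    (hξη : IsIncrements μ simpleWeights q ξ η) (hx : x ∈ quadrantSet) {h : ℤ × ℤ → ℕ → ℝ} {C : ℝ}
    (hC : ∀ y ∈ quadrantSet, ∀ k, |h y k| ≤ C)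
    (hT : ∀ y ∈ quadrantSet, ∀ k, transition q h y k = h y k) (n : ℕ) :
    ∫ ω, h (walk ξ η x n ω) (contactCount ξ η x n ω) ∂μ = h x 0 := by
  induction n with
  | zero => simp [walk, contactCount]
  | succ n ih =>
    rw [integral_walk_succ hq hξη hx hC, ← ih]
    refine integral_congr_ae ?_
    filter_upwards [ae_walk_mem_quadrantSet hq hξη hx n] with ω hω using hT _ hω _

lemma integral_walk_le_of_transition_le (hq : IsReflectionWeights q)
    (hξη : IsIncrements μ simpleWeights q ξ η) (hx : x ∈ quadrantSet) {h : ℤ × ℤ → ℕ → ℝ} {C r : ℝ}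
    (hC : ∀ y ∈ quadrantSet, ∀ k, |h y k| ≤ C) (hr : 0 ≤ r)
    (h0 : ∀ y ∈ quadrantSet, ∀ k, 0 ≤ transition q h y k)
    (hT : ∀ y ∈ quadrantSet, ∀ k, transition q h y k ≤ r * h y k) (n : ℕ) :
    ∫ ω, h (walk ξ η x n ω) (contactCount ξ η x n ω) ∂μ ≤ r ^ n * h x 0 := by
  induction n with
  | zero => simp [walk, contactCount]
  | succ n ih =>
    rw [integral_walk_succ hq hξη hx hC, pow_succ', mul_assoc]
    refine le_trans ?_ (mul_le_mul_of_nonneg_left ih hr)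
    rw [← integral_const_mul]
    refine integral_mono_of_nonneg ?_ ((integrable_walk hq hξη hx hC n).const_mul r) ?_
    · filter_upwards [ae_walk_mem_quadrantSet hq hξη hx n] with ω hω using h0 _ hω _
    · filter_upwards [ae_walk_mem_quadrantSet hq hξη hx n] with ω hω using hT _ hω _

end Transition

lemma hasSum_of_eq {ι M : Type*} [AddCommMonoid M] [TopologicalSpace M] {f g : ι → M} {a b : M}
    (h : HasSum f a) (hf : ∀ i, g i = f i) (hb : b = a) : HasSum g b := by
  rw [hb]
  exact h.congr_fun hf

/-! ### Exponential functions of the position -/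

/-- The function `(k, l) ↦ α ^ k * β ^ l` on the lattice. -/
noncomputable def expWeight (α β : ℝ) (y : ℤ × ℤ) : ℝ := α ^ y.1 * β ^ y.2

lemma expWeight_add {α β : ℝ} (hα : α ≠ 0) (hβ : β ≠ 0) (y s : ℤ × ℤ) :
    expWeight α β (y + s) = expWeight α β y * expWeight α β s := by
  simp only [expWeight, Prod.fst_add, Prod.snd_add, zpow_add₀ hα, zpow_add₀ hβ]
  ring

lemma expWeight_pos {α β : ℝ} (hα : 0 < α) (hβ : 0 < β) (y : ℤ × ℤ) : 0 < expWeight α β y := by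
  unfold expWeight
  positivity

lemma zpow_le_one_of_nonneg {α : ℝ} (hα : 0 < α) (hα1 : α ≤ 1) {k : ℤ} (hk : 0 ≤ k) :
    α ^ k ≤ 1 := by
  lift k to ℕ using hk
  rw [zpow_natCast]
  exact pow_le_one₀ hα.le hα1

lemma expWeight_le_one {α β : ℝ} (hα : 0 < α) (hα1 : α ≤ 1) (hβ : 0 < β) (hβ1 : β ≤ 1)
    {y : ℤ × ℤ} (hy : y ∈ quadrantSet) : expWeight α β y ≤ 1 :=
  mul_le_one₀ (zpow_le_one_of_nonneg hα hα1 hy.1) (zpow_nonneg hβ.le _)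
    (zpow_le_one_of_nonneg hβ hβ1 hy.2)

lemma zpow_le_zpow_of_nonneg {α γ : ℝ} (hα : 0 < α) (h : α ≤ γ) {k : ℤ} (hk : 0 ≤ k) :
    α ^ k ≤ γ ^ k := by
  lift k to ℕ using hk
  simp only [zpow_natCast]
  exact pow_le_pow_left₀ hα.le h k

lemma expWeight_mono {α β γ δ : ℝ} (hα : 0 < α) (hβ : 0 < β) (h : α ≤ γ) (h' : β ≤ δ)
    {y : ℤ × ℤ} (hy : y ∈ quadrantSet) : expWeight α β y ≤ expWeight γ δ y :=
  mul_le_mul (zpow_le_zpow_of_nonneg hα h hy.1) (zpow_le_zpow_of_nonneg hβ h' hy.2)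
    (zpow_nonneg hβ.le _) (zpow_nonneg (hα.le.trans h) _)

/-- The eigenvalue is 1 when `α, β ∈ {1, 1/3}`, and `15/16` at `(1/2, 1)` and `(1, 1/2)`; these are
the cases used. -/
lemma tsum_simpleWeights_mul_expWeight {α β : ℝ} (hα : α ≠ 0) (hβ : β ≠ 0) (y : ℤ × ℤ) :
    ∑' s, simpleWeights s * expWeight α β (y + s)
      = (3 / 8 * α + 3 / 8 * β + 1 / 8 * α⁻¹ + 1 / 8 * β⁻¹) * expWeight α β y := by
  rw [tsum_simpleWeights_mul]
  simp only [expWeight_add hα hβ]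
  simp only [expWeight, zpow_one, zpow_zero, zpow_neg]
  ring

lemma summable_simpleWeights_mul (f : ℤ × ℤ → ℝ) : Summable fun s => simpleWeights s * f s := by
  refine summable_of_ne_finset_zero (s := {((1 : ℤ), (0 : ℤ)), (0, 1), (-1, 0), (0, -1)}) ?_
  intro s hs
  simp only [Finset.mem_insert, Finset.mem_singleton, not_or] at hs
  simp [simpleWeights, hs]

lemma hasSum_simpleWeights_mul_expWeight {α β : ℝ} (hα : α ≠ 0) (hβ : β ≠ 0) (y : ℤ × ℤ) :
    HasSum (fun s => simpleWeights s * expWeight α β (y + s))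
      ((3 / 8 * α + 3 / 8 * β + 1 / 8 * α⁻¹ + 1 / 8 * β⁻¹) * expWeight α β y) := by
  rw [← tsum_simpleWeights_mul_expWeight hα hβ]
  exact (summable_simpleWeights_mul _).hasSum

lemma hasSum_simpleWeights : HasSum simpleWeights 1 := by
  have h := (summable_simpleWeights_mul fun _ => 1).hasSum
  rw [tsum_simpleWeights_mul] at h
  norm_num at h
  exact h

/-! ### The transform of the reflection law. -/

section Reflection

variable {q : ℤ × ℤ → ℝ} (hq : IsReflectionWeights q) {α β : ℝ}

include hq

lemma IsReflectionWeights.mul_expWeight_le (hα : 0 < α) (hα1 : α ≤ 1) (hβ : 0 < β) (hβ1 : β ≤ 1)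
    (s : ℤ × ℤ) : q s * expWeight α β s ≤ q s := by
  by_cases hs : q s = 0
  · simp [hs]
  · exact mul_le_of_le_one_right (hq.nonneg s)
      (expWeight_le_one hα hα1 hβ hβ1 (hq.mem_quadrantSet hs))

lemma IsReflectionWeights.hasSum_expWeight (hα : 0 < α) (hα1 : α ≤ 1) (hβ : 0 < β) (hβ1 : β ≤ 1) :
    HasSum (fun s => q s * expWeight α β s) (stepTransform q α β) := by
  have h : Summable fun s => q s * expWeight α β s :=
    Summable.of_nonneg_of_le (fun s => mul_nonneg (hq.nonneg s) (expWeight_pos hα hβ s).le)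
      (hq.mul_expWeight_le hα hα1 hβ hβ1) hq.hasSum_one.summable
  have e : stepTransform q α β = ∑' s, q s * expWeight α β s :=
    tsum_congr fun s => by rw [expWeight, mul_assoc]
  rw [e]
  exact h.hasSum

lemma IsReflectionWeights.hasSum_mul_expWeight_add (hα : 0 < α) (hα1 : α ≤ 1) (hβ : 0 < β)
    (hβ1 : β ≤ 1) (y : ℤ × ℤ) :
    HasSum (fun s => q s * expWeight α β (y + s)) (stepTransform q α β * expWeight α β y) := by
  refine ((hq.hasSum_expWeight hα hα1 hβ hβ1).mul_right (expWeight α β y)).congr_fun ?_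
  intro s
  rw [expWeight_add hα.ne' hβ.ne']
  ring

lemma IsReflectionWeights.stepTransform_nonneg (hα : 0 < α) (hβ : 0 < β) :
    0 ≤ stepTransform q α β :=
  tsum_nonneg fun s => mul_nonneg (mul_nonneg (hq.nonneg s) (zpow_nonneg hα.le _))
    (zpow_nonneg hβ.le _)

lemma IsReflectionWeights.stepTransform_le_one (hα : 0 < α) (hα1 : α ≤ 1) (hβ : 0 < β)
    (hβ1 : β ≤ 1) : stepTransform q α β ≤ 1 :=
  hasSum_le (hq.mul_expWeight_le hα hα1 hβ hβ1) (hq.hasSum_expWeight hα hα1 hβ hβ1) hq.hasSum_one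

lemma IsReflectionWeights.stepTransform_lt_one_of_exists (hα : 0 < α) (hα1 : α ≤ 1) (hβ : 0 < β)
    (hβ1 : β ≤ 1) (h : ∃ s, 0 < q s ∧ expWeight α β s < 1) : stepTransform q α β < 1 := by
  obtain ⟨s, hs, hs1⟩ := h
  exact hasSum_lt (hq.mul_expWeight_le hα hα1 hβ hβ1) (mul_lt_of_lt_one_right hs hs1)
    (hq.hasSum_expWeight hα hα1 hβ hβ1) hq.hasSum_one

/-- Otherwise every charged step has weight at least 1, which forces its first coordinate to be at
most 0 and contradicts the positive drift. -/
lemma IsReflectionWeights.stepTransform_lt_one_of_lt_left (hα : 0 < α) (hα1 : α < 1) (hβ : 0 < β)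
    (hβ1 : β ≤ 1) : stepTransform q α β < 1 := by
  refine hq.stepTransform_lt_one_of_exists hα hα1.le hβ hβ1 ?_
  by_contra! hcon
  refine hq.drift_fst_pos.not_ge (tsum_nonpos fun s => ?_)
  rcases (hq.nonneg s).eq_or_lt with h0 | h0
  · simp [← h0]
  · have hs := hq.mem_quadrantSet h0.ne'
    have h1 : α ^ s.1 * β ^ s.2 ≤ α ^ s.1 * 1 :=
      mul_le_mul_of_nonneg_left (zpow_le_one_of_nonneg hβ hβ1 hs.2) (zpow_nonneg hα.le _)
    have h2 : 1 ≤ α ^ s.1 := by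
      have := hcon s h0
      rw [expWeight] at this
      linarith
    have h3 : s.1 ≤ 0 := by
      by_contra! h
      exact absurd h2 (not_le.2 (zpow_lt_one₀ hα hα1 h))
    exact mul_nonpos_of_nonpos_of_nonneg (by exact_mod_cast h3) h0.le

lemma IsReflectionWeights.stepTransform_lt_one_of_lt_right (hα : 0 < α) (hα1 : α ≤ 1) (hβ : 0 < β)
    (hβ1 : β < 1) : stepTransform q α β < 1 := by
  refine hq.stepTransform_lt_one_of_exists hα hα1 hβ hβ1.le ?_
  by_contra! hcon
  refine hq.drift_snd_pos.not_ge (tsum_nonpos fun s => ?_)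
  rcases (hq.nonneg s).eq_or_lt with h0 | h0
  · simp [← h0]
  · have hs := hq.mem_quadrantSet h0.ne'
    have h1 : α ^ s.1 * β ^ s.2 ≤ 1 * β ^ s.2 :=
      mul_le_mul_of_nonneg_right (zpow_le_one_of_nonneg hα hα1 hs.1) (zpow_nonneg hβ.le _)
    have h2 : 1 ≤ β ^ s.2 := by
      have := hcon s h0
      rw [expWeight] at this
      linarith
    have h3 : s.2 ≤ 0 := by
      by_contra! h
      exact absurd h2 (not_le.2 (zpow_lt_one₀ hβ hβ1 h))
    exact mul_nonpos_of_nonpos_of_nonneg (by exact_mod_cast h3) h0.le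

end Reflection

/-! ### The candidate for the law of the number of contacts -/

/-- The coefficients of the power series `(1 - z) / (1 - z * Q)`. -/
noncomputable def compCoeff (Q : ℝ) : ℕ → ℝ
  | 0 => 1
  | n + 1 => -((1 - Q) * Q ^ n)

/-- Coefficient comparison in `(1 - z * Q) * ∑ cₙ zⁿ = 1 - z`; the correction at `n = 0` is the term
`-z`. -/
lemma compCoeff_succ (Q : ℝ) (n : ℕ) :
    compCoeff Q (n + 1) = Q * compCoeff Q n - if n = 0 then 1 else 0 := by
  rcases n with _ | n
  · simp [compCoeff]
  · simp [compCoeff]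
    ring

lemma abs_compCoeff_le {Q : ℝ} (h0 : 0 ≤ Q) (h1 : Q ≤ 1) (n : ℕ) : |compCoeff Q n| ≤ 1 := by
  rcases n with _ | n
  · simp [compCoeff]
  · rw [compCoeff, abs_neg, abs_of_nonneg (mul_nonneg (by linarith) (by positivity))]
    exact mul_le_one₀ (by linarith) (by positivity) (pow_le_one₀ h0 h1)

lemma norm_mul_ofReal_lt_one {Q : ℝ} (h0 : 0 ≤ Q) (h1 : Q < 1) {z : ℂ} (hz : ‖z‖ ≤ 1) :
    ‖z * (Q : ℂ)‖ < 1 := by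
  rw [norm_mul, Complex.norm_of_nonneg h0]
  exact lt_of_le_of_lt (mul_le_of_le_one_left h0 hz) h1

lemma one_sub_mul_ofReal_ne_zero {Q : ℝ} (h0 : 0 ≤ Q) (h1 : Q < 1) {z : ℂ} (hz : ‖z‖ ≤ 1) :
    1 - z * (Q : ℂ) ≠ 0 := fun h => by
  have := norm_mul_ofReal_lt_one h0 h1 hz
  rw [← sub_eq_zero.1 h, norm_one] at this
  exact lt_irrefl _ this

lemma hasSum_compCoeff {Q : ℝ} (h0 : 0 ≤ Q) (h1 : Q < 1) {z : ℂ} (hz : ‖z‖ ≤ 1) :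
    HasSum (fun n => (compCoeff Q n : ℂ) * z ^ n) ((1 - z) / (1 - z * (Q : ℂ))) := by
  have hne := one_sub_mul_ofReal_ne_zero h0 h1 hz
  rw [← hasSum_nat_add_iff' 1]
  have hg := (hasSum_geometric_of_norm_lt_one (norm_mul_ofReal_lt_one h0 h1 hz)).mul_left
    (-((1 - (Q : ℂ)) * z))
  refine hasSum_of_eq hg (fun n => ?_) ?_
  · simp only [compCoeff, Complex.ofReal_neg, Complex.ofReal_mul, Complex.ofReal_sub,
      Complex.ofReal_one, Complex.ofReal_pow]
    ring
  · simp only [Finset.range_one, Finset.sum_singleton, compCoeff, Complex.ofReal_one, pow_zero]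
    field_simp
    ring

/-- The closed form of the probability of `m` contacts for the walk started at `y`. -/
noncomputable def contactFormula (q : ℤ × ℤ → ℝ) (m : ℕ) (y : ℤ × ℤ) : ℝ :=
  (if m = 0 then 1 else 0)
    - compCoeff (stepTransform q (1 / 3) 1) m * expWeight (1 / 3) 1 y
    + compCoeff (stepTransform q (1 / 3) (1 / 3)) m * expWeight (1 / 3) (1 / 3) y
    - compCoeff (stepTransform q 1 (1 / 3)) m * expWeight 1 (1 / 3) y

lemma contactFormula_zero_of_mem_boundarySet {q : ℤ × ℤ → ℝ} {y : ℤ × ℤ} (hy : y ∈ boundarySet) :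
    contactFormula q 0 y = 0 := by
  have : y.1 = 0 ∨ y.2 = 0 := by
    have h1 := hy.1
    have h2 := hy.2.1
    have h3 := hy.2.2
    omega
  rcases this with h | h <;> simp [contactFormula, compCoeff, expWeight, h]

lemma hasSum_simpleWeights_mul_contactFormula (q : ℤ × ℤ → ℝ) (m : ℕ) (y : ℤ × ℤ) :
    HasSum (fun s => simpleWeights s * contactFormula q m (y + s)) (contactFormula q m y) := by
  have h1 := hasSum_simpleWeights_mul_expWeight (α := 1 / 3) (β := 1) (by norm_num) (by norm_num) y
  have h2 := hasSum_simpleWeights_mul_expWeight (α := 1 / 3) (β := 1 / 3) (by norm_num)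
    (by norm_num) y
  have h3 := hasSum_simpleWeights_mul_expWeight (α := 1) (β := 1 / 3) (by norm_num) (by norm_num) y
  have h := (((hasSum_simpleWeights.mul_right (if m = 0 then (1 : ℝ) else 0)).sub
    (h1.mul_left (compCoeff (stepTransform q (1 / 3) 1) m))).add
    (h2.mul_left (compCoeff (stepTransform q (1 / 3) (1 / 3)) m))).sub
    (h3.mul_left (compCoeff (stepTransform q 1 (1 / 3)) m))
  refine hasSum_of_eq h (fun s => ?_) ?_
  · simp only [contactFormula]
    ring
  · simp only [contactFormula]
    ring

lemma IsReflectionWeights.hasSum_mul_contactFormula {q : ℤ × ℤ → ℝ} (hq : IsReflectionWeights q)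
    (m : ℕ) {y : ℤ × ℤ} (hy : y ∈ boundarySet) :
    HasSum (fun s => q s * contactFormula q m (y + s)) (contactFormula q (m + 1) y) := by
  have h1 := hq.hasSum_mul_expWeight_add (α := 1 / 3) (β := 1) (by norm_num) (by norm_num)
    (by norm_num) (by norm_num) y
  have h2 := hq.hasSum_mul_expWeight_add (α := 1 / 3) (β := 1 / 3) (by norm_num) (by norm_num)
    (by norm_num) (by norm_num) y
  have h3 := hq.hasSum_mul_expWeight_add (α := 1) (β := 1 / 3) (by norm_num) (by norm_num)
    (by norm_num) (by norm_num) y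
  have h := (((hq.hasSum_one.mul_right (if m = 0 then (1 : ℝ) else 0)).sub
    (h1.mul_left (compCoeff (stepTransform q (1 / 3) 1) m))).add
    (h2.mul_left (compCoeff (stepTransform q (1 / 3) (1 / 3)) m))).sub
    (h3.mul_left (compCoeff (stepTransform q 1 (1 / 3)) m))
  refine hasSum_of_eq h (fun s => ?_) ?_
  · simp only [contactFormula]
    ring
  · have h0 := contactFormula_zero_of_mem_boundarySet (q := q) hy
    simp only [contactFormula, compCoeff, if_true] at h0
    simp only [contactFormula, compCoeff_succ, Nat.add_eq_zero_iff, one_ne_zero, and_false,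
      if_false]
    -- The constant term of the average and the corrections from `compCoeff_succ` occur only for `m
    -- = 0`, and together they form a multiple of `F 0 y = 0`.
    linear_combination (-(if m = 0 then (1 : ℝ) else 0)) * h0

/-- The bases 1/3 are raised to 1/2 because the exponentials in `contactFormula` are harmonic and do
not decay in mean, whereas those with 1/2 contract. Two of the three terms are dominated by
`expWeight (1 / 2) 1`, the third by `expWeight 1 (1 / 2)`. -/
lemma IsReflectionWeights.abs_contactFormula_sub_le {q : ℤ × ℤ → ℝ} (hq : IsReflectionWeights q)
    (m : ℕ) {y : ℤ × ℤ} (hy : y ∈ quadrantSet) :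
    |contactFormula q m y - if m = 0 then 1 else 0|
      ≤ 2 * (expWeight (1 / 2) 1 y + expWeight 1 (1 / 2) y) := by
  have bound : ∀ α β γ δ : ℝ, 0 < α → 0 < β → α ≤ γ → β ≤ δ → γ ≤ 1 → δ ≤ 1 →
      |compCoeff (stepTransform q α β) m * expWeight α β y| ≤ expWeight γ δ y := by
    intro α β γ δ hα hβ h h' hγ hδ
    rw [abs_mul, abs_of_pos (expWeight_pos hα hβ y)]
    exact (mul_le_of_le_one_left (expWeight_pos hα hβ y).le
      (abs_compCoeff_le (hq.stepTransform_nonneg hα hβ)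
        (hq.stepTransform_le_one hα (h.trans hγ) hβ (h'.trans hδ)) m)).trans
      (expWeight_mono hα hβ h h' hy)
  have h1 := bound (1 / 3) 1 (1 / 2) 1 (by norm_num) (by norm_num) (by norm_num) (by norm_num)
    (by norm_num) (by norm_num)
  have h2 := bound (1 / 3) (1 / 3) (1 / 2) 1 (by norm_num) (by norm_num) (by norm_num) (by norm_num)
    (by norm_num) (by norm_num)
  have h3 := bound 1 (1 / 3) 1 (1 / 2) (by norm_num) (by norm_num) (by norm_num) (by norm_num)
    (by norm_num) (by norm_num)
  have h4 := expWeight_pos (α := 1) (β := 1 / 2) (by norm_num) (by norm_num) y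
  rw [abs_le] at *
  unfold contactFormula
  constructor <;> linarith

/-- The closed form of the probability of `m` contacts in total, given `k` past contacts. -/
noncomputable def remainingFormula (q : ℤ × ℤ → ℝ) (m : ℕ) (y : ℤ × ℤ) (k : ℕ) : ℝ :=
  if k ≤ m then contactFormula q (m - k) y else 0

/-- The delicate case is the boundary with `k = m`: the next contact count exceeds `m`, so the
average is 0, matching `F 0 = 0` there. -/
lemma IsReflectionWeights.transition_remainingFormula {q : ℤ × ℤ → ℝ} (hq : IsReflectionWeights q)
    (m : ℕ) {y : ℤ × ℤ} (hy : y ∈ quadrantSet) (k : ℕ) :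
    transition q (remainingFormula q m) y k = remainingFormula q m y k := by
  rcases mem_interiorSet_or_mem_boundarySet hy with h | h
  · rw [transition_of_mem_interiorSet h]
    by_cases hk : k ≤ m
    · simpa [remainingFormula, hk] using
        (hasSum_simpleWeights_mul_contactFormula q (m - k) y).tsum_eq
    · simp [remainingFormula, hk]
  · rw [transition_of_mem_boundarySet h]
    rcases lt_trichotomy k m with hk | rfl | hk
    · have e : m - k = m - (k + 1) + 1 := by omega
      have hk' : k + 1 ≤ m := hk
      simp only [remainingFormula, hk', hk.le, if_true]
      rw [e]
      exact (hq.hasSum_mul_contactFormula (m - (k + 1)) h).tsum_eq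
    · simp [remainingFormula, contactFormula_zero_of_mem_boundarySet h]
    · simp [remainingFormula, not_le.2 hk, not_le.2 (hk.trans k.lt_succ_self)]

/-- A function of the walk decaying geometrically in mean. -/
noncomputable def decayWeight (y : ℤ × ℤ) (k : ℕ) : ℝ :=
  (1 / 2) ^ k * (expWeight (1 / 2) 1 y + expWeight 1 (1 / 2) y)

lemma decayWeight_nonneg (y : ℤ × ℤ) (k : ℕ) : 0 ≤ decayWeight y k := by
  have h1 := expWeight_pos (α := 1 / 2) (β := 1) (by norm_num) (by norm_num) y
  have h2 := expWeight_pos (α := 1) (β := 1 / 2) (by norm_num) (by norm_num) y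
  unfold decayWeight
  positivity

lemma abs_decayWeight_le {y : ℤ × ℤ} (hy : y ∈ quadrantSet) (k : ℕ) : |decayWeight y k| ≤ 2 := by
  rw [abs_of_nonneg (decayWeight_nonneg y k)]
  have h1 := expWeight_le_one (α := 1 / 2) (β := 1) (by norm_num) (by norm_num) (by norm_num)
    (by norm_num) hy
  have h2 := expWeight_le_one (α := 1) (β := 1 / 2) (by norm_num) (by norm_num) (by norm_num)
    (by norm_num) hy
  have h3 := expWeight_pos (α := 1 / 2) (β := 1) (by norm_num) (by norm_num) y
  have h4 := expWeight_pos (α := 1) (β := 1 / 2) (by norm_num) (by norm_num) y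
  have h5 : ((1 : ℝ) / 2) ^ k ≤ 1 := pow_le_one₀ (by norm_num) (by norm_num)
  unfold decayWeight
  exact (mul_le_of_le_one_left (by linarith) h5).trans (by linarith)

lemma simpleWeights_nonneg (s : ℤ × ℤ) : 0 ≤ simpleWeights s := by
  unfold simpleWeights
  split_ifs <;> norm_num

lemma IsReflectionWeights.transition_decayWeight_nonneg {q : ℤ × ℤ → ℝ}
    (hq : IsReflectionWeights q) (y : ℤ × ℤ) (k : ℕ) : 0 ≤ transition q decayWeight y k := by
  unfold transition
  refine add_nonneg ?_ ?_
  · split_ifs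
    · exact tsum_nonneg fun s => mul_nonneg (simpleWeights_nonneg s) (decayWeight_nonneg _ _)
    · exact le_rfl
  · split_ifs
    · exact tsum_nonneg fun s => mul_nonneg (hq.nonneg s) (decayWeight_nonneg _ _)
    · exact le_rfl

/-- In the interior the factor is exactly `3/16 + 3/8 + 1/4 + 1/8 = 15/16`. On the boundary the new
contact contributes `1/2` through `(1 / 2) ^ k`, so `stepTransform ≤ 1` suffices and the rate does
not depend on `q`. -/
lemma IsReflectionWeights.transition_decayWeight_le {q : ℤ × ℤ → ℝ} (hq : IsReflectionWeights q)
    {y : ℤ × ℤ} (hy : y ∈ quadrantSet) (k : ℕ) :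
    transition q decayWeight y k ≤ 15 / 16 * decayWeight y k := by
  rcases mem_interiorSet_or_mem_boundarySet hy with h | h
  · rw [transition_of_mem_interiorSet h]
    have h1 := hasSum_simpleWeights_mul_expWeight (α := 1 / 2) (β := 1) (by norm_num)
      (by norm_num) y
    have h2 := hasSum_simpleWeights_mul_expWeight (α := 1) (β := 1 / 2) (by norm_num)
      (by norm_num) y
    have h3 := (h1.add h2).mul_left ((1 / 2 : ℝ) ^ k)
    have e : ∀ s, simpleWeights s * decayWeight (y + s) k
        = (1 / 2 : ℝ) ^ k * (simpleWeights s * expWeight (1 / 2) 1 (y + s)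
          + simpleWeights s * expWeight 1 (1 / 2) (y + s)) := fun s => by
      unfold decayWeight
      ring
    rw [tsum_congr e, h3.tsum_eq]
    apply le_of_eq
    unfold decayWeight
    ring
  · rw [transition_of_mem_boundarySet h]
    have h1 := hq.hasSum_mul_expWeight_add (α := 1 / 2) (β := 1) (by norm_num) (by norm_num)
      (by norm_num) (by norm_num) y
    have h2 := hq.hasSum_mul_expWeight_add (α := 1) (β := 1 / 2) (by norm_num) (by norm_num)
      (by norm_num) (by norm_num) y
    have h3 := (h1.add h2).mul_left ((1 / 2 : ℝ) ^ (k + 1))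
    have e : ∀ s, q s * decayWeight (y + s) (k + 1)
        = (1 / 2 : ℝ) ^ (k + 1) * (q s * expWeight (1 / 2) 1 (y + s)
          + q s * expWeight 1 (1 / 2) (y + s)) := fun s => by
      unfold decayWeight
      ring
    rw [tsum_congr e, h3.tsum_eq]
    have a1 := mul_le_of_le_one_left
      (expWeight_pos (α := 1 / 2) (β := 1) (by norm_num) (by norm_num) y).le
      (hq.stepTransform_le_one (α := 1 / 2) (β := 1) (by norm_num) (by norm_num) (by norm_num)
        (by norm_num))
    have a2 := mul_le_of_le_one_left
      (expWeight_pos (α := 1) (β := 1 / 2) (by norm_num) (by norm_num) y).le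
      (hq.stepTransform_le_one (α := 1) (β := 1 / 2) (by norm_num) (by norm_num) (by norm_num)
        (by norm_num))
    calc _ ≤ (1 / 2 : ℝ) ^ (k + 1) * (expWeight (1 / 2) 1 y + expWeight 1 (1 / 2) y) :=
          mul_le_mul_of_nonneg_left (add_le_add a1 a2) (by positivity)
      _ = 1 / 2 * decayWeight y k := by
          unfold decayWeight
          ring
      _ ≤ 15 / 16 * decayWeight y k :=
          mul_le_mul_of_nonneg_right (by norm_num) (decayWeight_nonneg y k)

/-- For `k ≤ m` the factor `2 ^ m` compensates the `(1 / 2) ^ k` in `decayWeight`; for `k > m` the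
left side is 0. -/
lemma IsReflectionWeights.abs_remainingFormula_sub_le {q : ℤ × ℤ → ℝ} (hq : IsReflectionWeights q)
    (m : ℕ) {y : ℤ × ℤ} (hy : y ∈ quadrantSet) (k : ℕ) :
    |remainingFormula q m y k - if k = m then 1 else 0| ≤ 2 ^ (m + 1) * decayWeight y k := by
  by_cases hk : k ≤ m
  · have e : (if k = m then (1 : ℝ) else 0) = if m - k = 0 then 1 else 0 :=
      if_congr (by omega) rfl rfl
    rw [e, remainingFormula, if_pos hk]
    refine (hq.abs_contactFormula_sub_le (m - k) hy).trans ?_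
    have h3 := expWeight_pos (α := 1 / 2) (β := 1) (by norm_num) (by norm_num) y
    have h4 := expWeight_pos (α := 1) (β := 1 / 2) (by norm_num) (by norm_num) y
    have h5 : (1 : ℝ) ≤ 2 ^ m * (1 / 2) ^ k := by
      rw [one_div, inv_pow, ← div_eq_mul_inv, one_le_div (by positivity)]
      exact pow_le_pow_right₀ (by norm_num) hk
    unfold decayWeight
    calc _ ≤ 2 ^ m * (1 / 2) ^ k * (2 * (expWeight (1 / 2) 1 y + expWeight 1 (1 / 2) y)) :=
          le_mul_of_one_le_left (by positivity) h5
      _ = _ := by ring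
  · have hkm : k ≠ m := fun h => hk h.le
    rw [remainingFormula, if_neg hk, if_neg hkm, sub_zero, abs_zero]
    exact mul_nonneg (by positivity) (decayWeight_nonneg y k)

/-! ### The law of the number of contacts -/

section Law

variable {Ω : Type*} [MeasurableSpace Ω] {μ : Measure Ω} [IsProbabilityMeasure μ]
  {q : ℤ × ℤ → ℝ} {ξ η : ℕ → Ω → ℤ × ℤ} {x : ℤ × ℤ}

lemma tendsto_integral_contactCount (hξη : IsIncrements μ simpleWeights q ξ η) (m : ℕ) :
    Filter.Tendsto (fun n => ∫ ω, (if contactCount ξ η x n ω = m then (1 : ℝ) else 0) ∂μ)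
      Filter.atTop (nhds (μ.real {ω | contacts ξ η x ω = m})) := by
  classical
  have hm : ∀ n, Measurable (contactCount ξ η x n) := fun n =>
    measurable_contactCount (fun k _ => hξη.measurable_interior k)
      (fun k _ => hξη.measurable_boundary k)
  have hc : Measurable (contacts ξ η x) :=
    measurable_of_tendsto_metrizable (f := fun n ω => (contactCount ξ η x n ω : ℝ≥0∞))
      (fun n => (measurable_of_countable (fun k : ℕ => (k : ℝ≥0∞))).comp (hm n))
      (tendsto_pi_nhds.2 fun ω => tendsto_contactCount ω)
  have hset : MeasurableSet {ω | contacts ξ η x ω = m} := hc (measurableSet_singleton _)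
  rw [← integral_indicator_one hset]
  refine tendsto_integral_of_dominated_convergence (fun _ => 1) (fun n => ?_)
    (integrable_const _) (fun n => ?_) ?_
  · exact ((measurable_of_countable fun k : ℕ => if k = m then (1 : ℝ) else 0).comp
      (hm n)).aestronglyMeasurable
  · refine Filter.Eventually.of_forall fun ω => ?_
    split_ifs <;> simp
  · refine Filter.Eventually.of_forall fun ω => ?_
    refine tendsto_const_nhds.congr' ?_
    filter_upwards [eventually_contactCount_eq_iff (ξ := ξ) (η := η) (x := x) m ω] with n hn
    simp [Set.indicator_apply, hn]

lemma IsReflectionWeights.abs_remainingFormula_le (hq : IsReflectionWeights q)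
    (m : ℕ) {y : ℤ × ℤ} (hy : y ∈ quadrantSet) (k : ℕ) :
    |remainingFormula q m y k| ≤ 2 ^ (m + 1) * 2 + 1 := by
  have h1 := hq.abs_remainingFormula_sub_le m hy k
  have h2 := abs_le.1 (abs_decayWeight_le hy k)
  have h3 : (2 : ℝ) ^ (m + 1) * decayWeight y k ≤ 2 ^ (m + 1) * 2 :=
    mul_le_mul_of_nonneg_left h2.2 (by positivity)
  have h4 : 0 ≤ (if k = m then (1 : ℝ) else 0) ∧ (if k = m then (1 : ℝ) else 0) ≤ 1 := by
    split_ifs <;> norm_num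
  rw [abs_le] at *
  constructor <;> linarith [h4.1, h4.2]

theorem measureReal_contacts_eq (hq : IsReflectionWeights q)
    (hξη : IsIncrements μ simpleWeights q ξ η) (hx : x ∈ quadrantSet) (m : ℕ) :
    μ.real {ω | contacts ξ η x ω = m} = contactFormula q m x := by
  refine tendsto_nhds_unique (tendsto_integral_contactCount hξη m) ?_
  have hD : Filter.Tendsto (fun n : ℕ => (2 : ℝ) ^ (m + 1) * ((15 / 16) ^ n * decayWeight x 0))
      Filter.atTop (nhds 0) := by
    simpa using ((tendsto_pow_atTop_nhds_zero_of_lt_one (by norm_num : (0 : ℝ) ≤ 15 / 16)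
      (by norm_num)).mul_const (decayWeight x 0)).const_mul ((2 : ℝ) ^ (m + 1))
  -- The target is the constant mean of the martingale, so the error is a mean difference dominated
  -- by that of `decayWeight`.
  rw [tendsto_iff_norm_sub_tendsto_zero]
  refine squeeze_zero (fun _ => norm_nonneg _) (fun n => ?_) hD
  have hR := integral_walk_of_transition_eq hq hξη hx
    (fun y hy k => hq.abs_remainingFormula_le m hy k)
    (fun y hy k => hq.transition_remainingFormula m hy k) n
  have e : remainingFormula q m x 0 = contactFormula q m x := by simp [remainingFormula]
  have iR := integrable_walk hq hξη hx (fun y hy k => hq.abs_remainingFormula_le m hy k) n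
  have iI := integrable_walk hq hξη hx (h := fun _ k => if k = m then (1 : ℝ) else 0) (C := 1)
    (fun y _ k => by split_ifs <;> simp) n
  have iD := integrable_walk hq hξη hx (fun y hy k => abs_decayWeight_le hy k) n
  rw [← e, ← hR, norm_sub_rev, ← integral_sub iR iI]
  refine (norm_integral_le_of_norm_le (iD.const_mul (2 ^ (m + 1))) ?_).trans ?_
  · filter_upwards [ae_walk_mem_quadrantSet hq hξη hx n] with ω hω
      using hq.abs_remainingFormula_sub_le m hω _
  · rw [integral_const_mul]
    exact mul_le_mul_of_nonneg_left (integral_walk_le_of_transition_le hq hξη hx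
      (fun y hy k => abs_decayWeight_le hy k) (by norm_num)
      (fun y _ k => hq.transition_decayWeight_nonneg y k)
      (fun y hy k => hq.transition_decayWeight_le hy k) n) (by positivity)

theorem contactPmf_eq (hq : IsReflectionWeights q) (hξη : IsIncrements μ simpleWeights q ξ η)
    (m i j : ℕ) :
    contactPmf μ ξ η m i j = (if m = 0 then 1 else 0)
      - compCoeff (stepTransform q (1 / 3) 1) m * (1 / 3) ^ i
      + compCoeff (stepTransform q (1 / 3) (1 / 3)) m * ((1 / 3) ^ i * (1 / 3) ^ j)
      - compCoeff (stepTransform q 1 (1 / 3)) m * (1 / 3) ^ j := by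
  have hx : ((i : ℤ), (j : ℤ)) ∈ quadrantSet := ⟨Int.natCast_nonneg i, Int.natCast_nonneg j⟩
  rw [contactPmf, measureReal_contacts_eq hq hξη hx m]
  simp only [contactFormula, expWeight, zpow_natCast, one_pow, mul_one, one_mul]

end Law

end QuadrantWalk

theorem mainTheorem6 {Ω : Type*} [MeasurableSpace Ω] (μ : Measure Ω) [IsProbabilityMeasure μ]
    (q : ℤ × ℤ → ℝ) (hq : QuadrantWalk.IsReflectionWeights q)
    (ξ η : ℕ → Ω → ℤ × ℤ)
    (hξη : QuadrantWalk.IsIncrements μ QuadrantWalk.simpleWeights q ξ η)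
    (α₀ α₁ β₀ β₁ : ℝ) (hα₀ : α₀ = 1) (hβ₀ : β₀ = 1) (hα₁ : α₁ = 1 / 3) (hβ₁ : β₁ = 1 / 3)
    (i j : ℕ) :
    QuadrantWalk.contactPmf μ ξ η 0 i j
        = α₀ ^ i * β₀ ^ j - α₁ ^ i * β₀ ^ j + α₁ ^ i * β₁ ^ j - α₀ ^ i * β₁ ^ j ∧
    QuadrantWalk.contactPmf μ ξ η 0 i j = (1 - (1 / 3) ^ i) * (1 - (1 / 3) ^ j) ∧
    (∀ n : ℕ, 1 ≤ n →
      QuadrantWalk.contactPmf μ ξ η n i j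
        = (1 - QuadrantWalk.stepTransform q α₁ β₀)
            * QuadrantWalk.stepTransform q α₁ β₀ ^ (n - 1) * (α₁ ^ i * β₀ ^ j)
          - (1 - QuadrantWalk.stepTransform q α₁ β₁)
            * QuadrantWalk.stepTransform q α₁ β₁ ^ (n - 1) * (α₁ ^ i * β₁ ^ j)
          + (1 - QuadrantWalk.stepTransform q α₀ β₁)
            * QuadrantWalk.stepTransform q α₀ β₁ ^ (n - 1) * (α₀ ^ i * β₁ ^ j)) ∧
    (∀ z : ℂ, ‖z‖ ≤ 1 →
      1 - z * (QuadrantWalk.stepTransform q α₁ β₀ : ℂ) ≠ 0 ∧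
      1 - z * (QuadrantWalk.stepTransform q α₁ β₁ : ℂ) ≠ 0 ∧
      1 - z * (QuadrantWalk.stepTransform q α₀ β₁ : ℂ) ≠ 0 ∧
      HasSum (fun n : ℕ => (QuadrantWalk.contactPmf μ ξ η n i j : ℂ) * z ^ n)
        ((α₀ : ℂ) ^ i * (β₀ : ℂ) ^ j
          - (1 - z) / (1 - z * (QuadrantWalk.stepTransform q α₁ β₀ : ℂ))
            * ((α₁ : ℂ) ^ i * (β₀ : ℂ) ^ j)
          + (1 - z) / (1 - z * (QuadrantWalk.stepTransform q α₁ β₁ : ℂ))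
            * ((α₁ : ℂ) ^ i * (β₁ : ℂ) ^ j)
          - (1 - z) / (1 - z * (QuadrantWalk.stepTransform q α₀ β₁ : ℂ))
            * ((α₀ : ℂ) ^ i * (β₁ : ℂ) ^ j))) := by
  subst hα₀ hβ₀ hα₁ hβ₁
  have hf := QuadrantWalk.contactPmf_eq hq hξη
  have n10 := hq.stepTransform_nonneg (α := 1 / 3) (β := 1) (by norm_num) (by norm_num)
  have n11 := hq.stepTransform_nonneg (α := 1 / 3) (β := 1 / 3) (by norm_num) (by norm_num)
  have n01 := hq.stepTransform_nonneg (α := 1) (β := 1 / 3) (by norm_num) (by norm_num)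
  -- Strict inequality, which rests on the positive drifts, is needed to cover the whole closed
  -- disc, including `‖z‖ = 1`.
  have l10 := hq.stepTransform_lt_one_of_lt_left (α := 1 / 3) (β := 1) (by norm_num) (by norm_num)
    (by norm_num) (by norm_num)
  have l11 := hq.stepTransform_lt_one_of_lt_left (α := 1 / 3) (β := 1 / 3) (by norm_num)
    (by norm_num) (by norm_num) (by norm_num)
  have l01 := hq.stepTransform_lt_one_of_lt_right (α := 1) (β := 1 / 3) (by norm_num)
    (by norm_num) (by norm_num) (by norm_num)
  refine ⟨?_, ?_, fun n hn => ?_, fun z hz => ⟨?_, ?_, ?_, ?_⟩⟩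
  · rw [hf]
    simp [QuadrantWalk.compCoeff]
  · rw [hf]
    simp only [QuadrantWalk.compCoeff, if_true]
    ring
  · obtain ⟨n, rfl⟩ := Nat.exists_eq_add_of_le' hn
    rw [hf]
    simp only [QuadrantWalk.compCoeff, Nat.add_eq_zero_iff, one_ne_zero, and_false, if_false,
      one_pow, Nat.add_sub_cancel]
    ring
  · exact QuadrantWalk.one_sub_mul_ofReal_ne_zero n10 l10 hz
  · exact QuadrantWalk.one_sub_mul_ofReal_ne_zero n11 l11 hz
  · exact QuadrantWalk.one_sub_mul_ofReal_ne_zero n01 l01 hz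
  · have h0 : HasSum (fun n : ℕ => (if n = 0 then (1 : ℂ) else 0) * z ^ n) 1 := by
      convert hasSum_ite_eq (0 : ℕ) (1 : ℂ) using 2 with n
      split_ifs with h <;> simp [h]
    have h := ((h0.sub ((QuadrantWalk.hasSum_compCoeff n10 l10 hz).mul_right ((1 / 3 : ℂ) ^ i))).add
      ((QuadrantWalk.hasSum_compCoeff n11 l11 hz).mul_right ((1 / 3 : ℂ) ^ i * (1 / 3) ^ j))).sub
      ((QuadrantWalk.hasSum_compCoeff n01 l01 hz).mul_right ((1 / 3 : ℂ) ^ j))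
    refine QuadrantWalk.hasSum_of_eq h (fun n => ?_) ?_
    · rw [hf]
      push_cast
      split_ifs <;> push_cast <;> ring
    · push_cast
      simp only [one_pow, mul_one, one_mul]
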